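/- **Theorem.** A 0DMC space is a zero-dimensional (having a basis of clopen sets) metrizable compact space, possibly empty. A graph on a set is a symmetric irreflexive relation. For a graph $G$ on a topological space $X$, the continuous chromatic number $\chi_c(X,G)$ is the least cardinal $\kappa\le\aleph_0$ for which there is a continuous map $c:X\to\kappa$ ($\kappa$ discrete) with $c(x)\ne c(y)$ whenever $(x,y)\in G$, if such a $\kappa$ exists, and $2^{\aleph_0}$ otherwise. Write $(X,G)\preceq_c(Y,H)$ if there is a continuous $\varphi:X\to Y$ with $G\subseteq(\varphi\times\varphi)^{-1}(H)$, and $(X,G)\preceq^i_c(Y,H)$ if $\varphi$ can moreover be taken injective. For $f:X\to X$ let $G_f:=\{(x,y)\in X^2\mid x\ne y \text{ and } (f(x)=y\text{ or }f(y)=x)\}$. For $\kappa\in\{0,1,2,3\}$ let $\mathfrak{G}_\kappa$ be the class of all $(X,G_f)$, where $X$ is a 0DMC space, $f$ is a homeomorphism of $X$ onto itself, and $\chi_c(X,G_f)>\kappa$. For a quasi-order $\le$ on a class $\Gamma$, a basis is a subclass $\mathfrak{B}\subseteq\Gamma$ such that every element of $\Gamma$ is $\le$-above an element of $\mathfrak{B}$,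 an antichain is a subclass whose distinct elements are pairwise $\le$-incomparable, and a minimum of $\Gamma$ is an element of $\Gamma$ that is $\le$-below every element of $\Gamma$. Let $\mathbb{X}_1:=\{0^\infty\}\cup\{0^n1^\infty\mid n\in\omega\}\subseteq 2^\omega$, and let $f_1:\mathbb{X}_1\to\mathbb{X}_1$ be given by $f_1(0^\infty)=0^\infty$ and $f_1(0^{2n+\varepsilon}1^\infty)=0^{2n+1-\varepsilon}1^\infty$ for $n\in\omega$, $\varepsilon\in\{0,1\}$. Then: (a) $(1,\emptyset)$ (the one-point space with the empty graph) is $\preceq^i_c$-minimum in $\mathfrak{G}_0$. (b) $(2,G_{\varepsilon\mapsto 1-\varepsilon})$, on the discrete space $2=\{0,1\}$, is $\preceq^i_c$-minimum in $\mathfrak{G}_1$. (c) Any $\preceq^i_c$-basis for $\mathfrak{G}_2$ has size continuum: it has at least $2^{\aleph_0}$ elements, and, counted up to isomorphism (homeomorphisms of the spaces that are isomorphisms of the graphs), it has exactly $2^{\aleph_0}$ elements. (d) $(\mathbb{X}_1,G_{f_1})$ is $\preceq^i_c$-minimum in $\mathfrak{G}_3$. Moreover, for each $\kappa\in\{0,1,2,3\}$,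 neither $(\mathfrak{G}_\kappa,\preceq^i_c)$ nor $(\mathfrak{G}_\kappa,\preceq_c)$ is well-founded (that is, the strict part of the quasi-order is not well-founded on $\mathfrak{G}_\kappa$); for each $\kappa\in\{0,1,2,3\}$, $\mathfrak{G}_\kappa$ contains a $\preceq^i_c$-antichain of size continuum; and for each $\kappa\in\{0,1,2\}$, $\mathfrak{G}_\kappa$ contains a $\preceq_c$-antichain of size continuum. -/

import Mathlib

open scoped Cardinal

/-- A topological space together with a graph (a symmetric irreflexive relation) on its points. -/
structure TopGraph where
  carrier : Type
  [top : TopologicalSpace carrier]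
  graph : SimpleGraph carrier

namespace TopGraph

attribute [instance] TopGraph.top

/-- The space is a 0DMC space: compact, metrizable, with a basis of clopen sets.
The empty space is allowed. -/
def IsZeroDMC (X : Type) [TopologicalSpace X] : Prop :=
  CompactSpace X ∧ TopologicalSpace.MetrizableSpace X ∧
    TopologicalSpace.IsTopologicalBasis {s : Set X | IsClopen s}

/-- The graph `G_f = s(Graph f) \ Δ(X)` induced by a function `f : X → X`: two points are adjacent
iff they are distinct and one of them is the image of the other. -/
def inducedGraph {X : Type} (f : X → X) : SimpleGraph X :=
  SimpleGraph.fromRel (fun x y => f x = y)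

/-- There is a continuous (proper) coloring with values in the cardinal `κ`, where the set of
colors carries the discrete topology. -/
def ContColorable (G : TopGraph) (κ : Cardinal.{0}) : Prop :=
  ∃ c : G.graph.Coloring κ.out, @Continuous G.carrier κ.out G.top ⊥ c

open Classical in
/-- The continuous chromatic number: the least cardinal `κ ≤ ℵ₀` for which there is a continuous
coloring with values in `κ` if there is one, and the continuum otherwise. -/
noncomputable def ccn (G : TopGraph) : Cardinal.{0} :=
  if ∃ κ : Cardinal.{0}, κ ≤ ℵ₀ ∧ G.ContColorable κ then
    sInf {κ : Cardinal.{0} | κ ≤ ℵ₀ ∧ G.ContColorable κ}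
  else 𝔠

/-- `G ≼_c H`: there is a continuous homomorphism from `G` to `H`. -/
def LEc (G H : TopGraph) : Prop :=
  ∃ φ : G.graph →g H.graph, Continuous φ

/-- `G ≼ⁱ_c H`: there is an injective continuous homomorphism from `G` to `H`. -/
def LEic (G H : TopGraph) : Prop :=
  ∃ φ : G.graph →g H.graph, Continuous φ ∧ Function.Injective φ

/-- The class `𝔊_κ` of graphs induced by a total homeomorphism of a 0DMC space
with continuous chromatic number strictly bigger than `κ`. -/
def classG (κ : ℕ) : Set TopGraph :=
  {G | IsZeroDMC G.carrier ∧ (∃ f : G.carrier ≃ₜ G.carrier, G.graph = inducedGraph f) ∧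
    (κ : Cardinal.{0}) < G.ccn}

/-- `b` is an `r`-minimum element of the class `Γ`. -/
def IsMinimumOf (r : TopGraph → TopGraph → Prop) (Γ : Set TopGraph) (b : TopGraph) : Prop :=
  b ∈ Γ ∧ ∀ G ∈ Γ, r b G

/-- `B` is an `r`-basis of the class `Γ`. -/
def IsBasisOf (r : TopGraph → TopGraph → Prop) (Γ B : Set TopGraph) : Prop :=
  B ⊆ Γ ∧ ∀ G ∈ Γ, ∃ b ∈ B, r b G

/-- The strict part of a quasi-order. -/
def strictPart (r : TopGraph → TopGraph → Prop) (G H : TopGraph) : Prop :=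
  r G H ∧ ¬ r H G

/-- Isomorphism: a homeomorphism of the spaces which is an isomorphism of the graphs. -/
def isoSetoid : Setoid TopGraph where
  r G H := ∃ φ : G.graph ≃g H.graph, Continuous φ ∧ Continuous φ.symm
  iseqv :=
    { refl := fun _ => ⟨RelIso.refl _, continuous_id, continuous_id⟩
      symm := fun ⟨φ, h₁, h₂⟩ => ⟨φ.symm, h₂, h₁⟩
      trans := fun ⟨φ, h₁, h₂⟩ ⟨ψ, k₁, k₂⟩ => ⟨φ.trans ψ, k₁.comp h₁, h₂.comp k₂⟩ }

/-- The set of isomorphism classes of the members of `B`. -/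
def isoClasses (B : Set TopGraph) : Set (Quotient isoSetoid) :=
  Quotient.mk isoSetoid '' B

/-- The one-point space with the empty graph. -/
def onePoint : TopGraph where
  carrier := Fin 1
  graph := ⊥

/-- The discrete space `2 = {0, 1}` with the graph induced by `ε ↦ 1 - ε`. -/
def twoPoint : TopGraph where
  carrier := Fin 2
  graph := inducedGraph (fun ε => 1 - ε)

/-- The sequence `0^∞` in `2^ω`. -/
def zeroSeq : ℕ → Fin 2 := fun _ => 0

/-- The sequence `0^n 1^∞` in `2^ω`. -/
def zeroOneSeq (n : ℕ) : ℕ → Fin 2 := fun i => if i < n then 0 else 1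

/-- The subspace `𝕏₁ = {0^∞} ∪ {0^n 1^∞ | n ∈ ω}` of `2^ω`. -/
def X₁ : Set (ℕ → Fin 2) := {zeroSeq} ∪ Set.range zeroOneSeq

/-- The map `2n + ε ↦ 2n + 1 - ε` (for `ε ∈ {0, 1}`) on natural numbers. -/
def flip (m : ℕ) : ℕ := if m % 2 = 0 then m + 1 else m - 1

open Classical in
/-- The map `f₁` on `𝕏₁` with `f₁(0^∞) = 0^∞` and `f₁(0^{2n+ε} 1^∞) = 0^{2n+1-ε} 1^∞`. -/
noncomputable def f₁ (x : X₁) : X₁ :=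
  if h : ∃ m, x.1 = zeroOneSeq m then
    ⟨zeroOneSeq (flip h.choose), Or.inr ⟨_, rfl⟩⟩
  else ⟨zeroSeq, Or.inl rfl⟩

theorem zeroOneSeq_injective : Function.Injective zeroOneSeq := by
  intro m n h
  by_contra hne
  rcases Nat.lt_or_gt_of_ne hne with hl | hl
  · have := congrFun h m
    simp [zeroOneSeq, hl] at this
  · have := congrFun h n
    simp [zeroOneSeq, hl] at this

theorem f₁_zeroSeq : f₁ ⟨zeroSeq, Or.inl rfl⟩ = ⟨zeroSeq, Or.inl rfl⟩ := by
  have h : ¬ ∃ m, zeroSeq = zeroOneSeq m := by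
    rintro ⟨m, hm⟩
    have := congrFun hm m
    simp [zeroSeq, zeroOneSeq] at this
  simp [f₁, h]

theorem f₁_zeroOneSeq (n ε : ℕ) (hε : ε < 2) :
    f₁ ⟨zeroOneSeq (2 * n + ε), Or.inr ⟨_, rfl⟩⟩ =
      ⟨zeroOneSeq (2 * n + 1 - ε), Or.inr ⟨_, rfl⟩⟩ := by
  have h : ∃ m, zeroOneSeq (2 * n + ε) = zeroOneSeq m := ⟨_, rfl⟩
  have hc : h.choose = 2 * n + ε := (zeroOneSeq_injective h.choose_spec).symm
  have hf : flip (2 * n + ε) = 2 * n + 1 - ε := by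
    unfold flip
    split_ifs <;> omega
  unfold f₁
  rw [dif_pos h]
  simp only [hc, hf]

/-- The space `𝕏₁` with the graph induced by `f₁`. -/
noncomputable def graphX₁ : TopGraph where
  carrier := X₁
  graph := inducedGraph f₁

end TopGraph

namespace TopGraph

open Topology Filter

/-! ### Colorings and the continuous chromatic number -/

/-! Membership in `classG 0` means having a point, and in `classG 1` having an edge. Every vertex
has degree at most two, so a finite continuous coloring reduces to three colors. By compactness such
a coloring exists once the fixed points form an open set (`exists_three_coloring`). Hence a member
of `classG 3` has a fixed point that is a limit of moved points, and disjoint edges converging to it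
form a copy of `graphX₁`.

For `classG 2`, translation by one on the odometer of a nonempty set `S` of odd primes has no
continuous 2-coloring, since odd integers tend to zero there. If a member of `classG 2` embeds in
the odometers of both `S` and `S'`, some orbit has more than two points and both embeddings follow
it in a constant direction. Recurrence seen in one odometer must then be recurrence in the other,
which forces `S = S'` (`Odometer.subset_of_common_leic`). Continuum many odometers thus have
pairwise no common lower bound in `classG 2`, so a basis is large; closed codes in the Hilbert cube
bound it above up to isomorphism. The odometers are also a `LEc`-antichain, because the net drift of
a homomorphism over an odd period is odd, hence nonzero (`Odometer.subset_of_lec`).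

Products of odd prime cycles, each with a fixed point added, lie in `classG 3` when there are
infinitely many cycles. Comparing cycle lengths yields the `LEic`-antichains, and deleting the
primes one by one yields the descending chains. -/

theorem contColorable_mono {G : TopGraph} {κ μ : Cardinal.{0}} (h : κ ≤ μ)
    (hG : G.ContColorable κ) : G.ContColorable μ := by
  obtain ⟨c, hc⟩ := hG
  rw [← Cardinal.mk_out κ, ← Cardinal.mk_out μ] at h
  obtain ⟨e⟩ := h
  let _ : TopologicalSpace κ.out := ⊥
  let _ : TopologicalSpace μ.out := ⊥
  have : DiscreteTopology κ.out := ⟨rfl⟩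
  exact ⟨SimpleGraph.Coloring.mk (fun x => e (c x)) fun h' he => c.valid h' (e.injective he),
    (continuous_of_discreteTopology (f := e)).comp hc⟩

theorem contColorable_natCast_iff {G : TopGraph} {n : ℕ} :
    G.ContColorable n ↔ ∃ c : G.carrier → Fin n, Continuous c ∧
      ∀ x y, G.graph.Adj x y → c x ≠ c y := by
  have hn : Cardinal.mk (n : Cardinal.{0}).out = Cardinal.mk (Fin n) := by simp
  obtain ⟨e⟩ := Cardinal.eq.1 hn
  let _ : TopologicalSpace (n : Cardinal.{0}).out := ⊥
  have : DiscreteTopology (n : Cardinal.{0}).out := ⟨rfl⟩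
  constructor
  · rintro ⟨c, hc⟩
    exact ⟨fun x => e (c x), continuous_of_discreteTopology.comp hc,
      fun x y h he => c.valid h (e.injective he)⟩
  · rintro ⟨c, hc, h⟩
    exact ⟨SimpleGraph.Coloring.mk (fun x => e.symm (c x))
      fun h' he => h _ _ h' (e.symm.injective he),
      (continuous_of_discreteTopology (f := e.symm)).comp hc⟩

theorem natCast_lt_ccn_iff {G : TopGraph} {n : ℕ} :
    (n : Cardinal.{0}) < G.ccn ↔ ¬ G.ContColorable n := by
  have hn : (n : Cardinal.{0}) ≤ ℵ₀ := (Cardinal.natCast_lt_aleph0).le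
  constructor
  · intro h hc
    have hex : ∃ κ : Cardinal.{0}, κ ≤ ℵ₀ ∧ G.ContColorable κ := ⟨n, hn, hc⟩
    rw [ccn, if_pos hex] at h
    exact absurd (csInf_le' (s := {κ : Cardinal.{0} | κ ≤ ℵ₀ ∧ G.ContColorable κ}) ⟨hn, hc⟩)
      (not_le.2 h)
  · intro hc
    rw [ccn]
    split_ifs with hex
    · have hm := csInf_mem (s := {κ : Cardinal.{0} | κ ≤ ℵ₀ ∧ G.ContColorable κ}) hex
      by_contra hlt
      exact hc (contColorable_mono (not_lt.1 hlt) hm.2)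
    -- The default value `𝔠` exceeds every finite cardinal.
    · exact Cardinal.natCast_lt_aleph0.trans Cardinal.aleph0_lt_continuum

theorem classG_anti {m n : ℕ} (h : m ≤ n) : classG n ⊆ classG m := fun _ hG =>
  ⟨hG.1, hG.2.1, lt_of_le_of_lt (Nat.cast_le.2 h) hG.2.2⟩

theorem mem_classG_iff {G : TopGraph} {n : ℕ} :
    G ∈ classG n ↔ IsZeroDMC G.carrier ∧
      (∃ f : G.carrier ≃ₜ G.carrier, G.graph = inducedGraph f) ∧
      ∀ c : G.carrier → Fin n, Continuous c → ∃ x y, G.graph.Adj x y ∧ c x = c y := by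
  simp only [classG, Set.mem_ofPred_eq, natCast_lt_ccn_iff, contColorable_natCast_iff]
  push Not
  rfl

theorem inducedGraph_adj {X : Type} {f : X → X} {x y : X} :
    (inducedGraph f).Adj x y ↔ x ≠ y ∧ (f x = y ∨ f y = x) := by
  simp [inducedGraph, SimpleGraph.fromRel_adj]

theorem inducedGraph_adj_apply {X : Type} {f : X → X} {x : X} (h : f x ≠ x) :
    (inducedGraph f).Adj x (f x) := inducedGraph_adj.2 ⟨h.symm, Or.inl rfl⟩

theorem LEc.refl (G : TopGraph) : LEc G G := ⟨SimpleGraph.Hom.id, continuous_id⟩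

theorem LEic.refl (G : TopGraph) : LEic G G :=
  ⟨SimpleGraph.Hom.id, continuous_id, Function.injective_id⟩

theorem LEic.lec {G H : TopGraph} (h : LEic G H) : LEc G H := ⟨h.choose, h.choose_spec.1⟩

theorem LEic.trans {G H K : TopGraph} : LEic G H → LEic H K → LEic G K :=
  fun ⟨φ, h₁, h₂⟩ ⟨ψ, k₁, k₂⟩ => ⟨ψ.comp φ, k₁.comp h₁, k₂.comp h₂⟩

theorem isZeroDMC_of_totallyDisconnected (X : Type) [TopologicalSpace X] [CompactSpace X]
    [TopologicalSpace.MetrizableSpace X] [TotallyDisconnectedSpace X] : IsZeroDMC X :=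
  ⟨inferInstance, inferInstance, isTopologicalBasis_isClopen⟩

theorem isZeroDMC_pi {ι : Type} [Countable ι] (F : ι → Type) [∀ i, TopologicalSpace (F i)]
    [∀ i, DiscreteTopology (F i)] [∀ i, Finite (F i)] : IsZeroDMC (∀ i, F i) :=
  isZeroDMC_of_totallyDisconnected _

/-! ### The minimum of `classG 0` and of `classG 1` -/

theorem onePoint_isMinimum : IsMinimumOf LEic (classG 0) onePoint := by
  constructor
  · refine mem_classG_iff.2 ⟨isZeroDMC_of_totallyDisconnected (Fin 1), ⟨Homeomorph.refl _, ?_⟩,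
      fun c _ => (c (0 : Fin 1)).elim0⟩
    ext x y
    rw [Subsingleton.elim (α := Fin 1) x y]
    exact iff_of_false (SimpleGraph.irrefl _) (SimpleGraph.irrefl _)
  · intro G hG
    have hne : Nonempty G.carrier := by
      by_contra hemp
      rw [not_nonempty_iff] at hemp
      obtain ⟨x, -⟩ := (mem_classG_iff.1 hG).2.2 (fun x => (hemp.false x).elim)
        (continuous_of_const fun x => (hemp.false x).elim)
      exact hemp.false x
    obtain ⟨x⟩ := hne
    exact ⟨⟨fun _ => x, fun h => h.elim⟩, continuous_const,
      fun a b _ => Subsingleton.elim (α := Fin 1) a b⟩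

theorem twoPoint_isMinimum : IsMinimumOf LEic (classG 1) twoPoint := by
  constructor
  · refine mem_classG_iff.2 ⟨isZeroDMC_of_totallyDisconnected (Fin 2),
      ⟨⟨⟨fun ε : Fin 2 => 1 - ε, fun ε : Fin 2 => 1 - ε, ?_, ?_⟩,
        continuous_of_discreteTopology (α := Fin 2),
        continuous_of_discreteTopology (α := Fin 2)⟩, rfl⟩,
      fun c _ => ⟨(0 : Fin 2), (1 : Fin 2), ?_, Subsingleton.elim _ _⟩⟩
    · exact fun ε : Fin 2 => sub_sub_cancel 1 ε
    · exact fun ε : Fin 2 => sub_sub_cancel 1 ε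
    · exact inducedGraph_adj.2 (show (0 : Fin 2) ≠ 1 ∧ ((1 : Fin 2) - 0 = 1 ∨ (1 : Fin 2) - 1 = 0) by
        simp)
  · intro G hG
    obtain ⟨x, y, hxy, -⟩ := (mem_classG_iff.1 hG).2.2 (fun _ => 0) continuous_const
    have hφ : ∀ a b : Fin 2, a ≠ b → G.graph.Adj (if a = 0 then x else y) (if b = 0 then x else y) := by
      intro a b
      fin_cases a <;> fin_cases b <;> simp [hxy, hxy.symm]
    refine ⟨⟨fun ε : Fin 2 => if ε = 0 then x else y,
      fun {a b} hab => hφ a b (inducedGraph_adj.1 hab).1⟩,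
      continuous_of_discreteTopology (α := Fin 2), fun a b hab => ?_⟩
    by_contra hne
    exact (hφ a b hne).ne hab

/-! ### Isomorphism classes -/

/-- A closed set is determined by the members of a countable basis that miss it. -/
theorem mk_isClosed_le_continuum (Y : Type) [TopologicalSpace Y] [SecondCountableTopology Y] :
    #{C : Set Y // IsClosed C} ≤ 𝔠 := by
  set B := TopologicalSpace.countableBasis Y
  have hB := TopologicalSpace.isBasis_countableBasis Y
  have hBc : Countable B := (TopologicalSpace.countable_countableBasis Y).to_subtype
  have hinj : Function.Injective
      (fun C : {C : Set Y // IsClosed C} => {b : B | Disjoint (b : Set Y) C.1}) := by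
    have key : ∀ C D : {C : Set Y // IsClosed C},
        {b : B | Disjoint (b : Set Y) C.1} = {b : B | Disjoint (b : Set Y) D.1} →
        D.1 ⊆ C.1 := by
      intro C D h x hx
      by_contra hxC
      obtain ⟨b, hb, hxb, hbC⟩ := hB.exists_subset_of_mem_open
        (Set.mem_compl hxC) C.2.isOpen_compl
      have : (⟨b, hb⟩ : B) ∈ {b : B | Disjoint (b : Set Y) D.1} :=
        h ▸ (Set.subset_compl_iff_disjoint_right.1 hbC : Disjoint b C.1)
      exact (Set.disjoint_left.1 this) hxb hx
    intro C D h
    exact Subtype.ext ((key _ _ h.symm).antisymm (key _ _ h))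
  refine (Cardinal.mk_le_of_injective hinj).trans ?_
  rw [Cardinal.mk_set, ← Cardinal.two_power_aleph0]
  exact Cardinal.power_le_power_left two_ne_zero Cardinal.mk_le_aleph0

/-- The image of the graph of a homeomorphism inducing the edges of `G` under an embedding of
the space into the Hilbert cube. -/
def IsCode (G : TopGraph) (R : Set ((ℕ → unitInterval) × (ℕ → unitInterval))) : Prop :=
  ∃ (e : G.carrier → ℕ → unitInterval) (f : G.carrier ≃ₜ G.carrier),
    IsClosedEmbedding e ∧ G.graph = inducedGraph f ∧ R = Set.range fun x => (e x, e (f x))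

theorem exists_isCode {G : TopGraph} {n : ℕ} (hG : G ∈ classG n) :
    ∃ R, IsClosed R ∧ IsCode G R := by
  obtain ⟨⟨h₁, h₂, -⟩, ⟨f, hf⟩, -⟩ := hG
  let _ := TopologicalSpace.metrizableSpaceMetric G.carrier
  obtain ⟨e, he⟩ := Metric.PiNatEmbed.exists_embedding_to_hilbert_cube (X := G.carrier)
  replace he := he.continuous.isClosedEmbedding he.injective
  exact ⟨_, (isCompact_range (he.continuous.prodMk (he.continuous.comp f.continuous))).isClosed,
    e, f, he, hf, rfl⟩

/-- The first projection of the code recovers the embedded space, and the code itself is the graph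
of the transported homeomorphism. -/
theorem IsCode.isoSetoid_r {G H : TopGraph} {R} (hG : IsCode G R) (hH : IsCode H R) :
    isoSetoid.r G H := by
  obtain ⟨e, f, he, hf, rfl⟩ := hG
  obtain ⟨e', f', he', hf', hR⟩ := hH
  have hrange : Set.range e = Set.range e' := by
    have := congrArg (Prod.fst '' ·) hR
    simpa only [← Set.range_comp, Function.comp_def] using this
  let φ : G.carrier ≃ₜ H.carrier := he.isEmbedding.toHomeomorph.trans
    ((Homeomorph.setCongr hrange).trans he'.isEmbedding.toHomeomorph.symm)
  have hφ : ∀ x, e' (φ x) = e x := fun x => by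
    have := he'.isEmbedding.toHomeomorph.apply_symm_apply
      ((Homeomorph.setCongr hrange) (he.isEmbedding.toHomeomorph x))
    exact congrArg Subtype.val this
  have hconj : ∀ x, φ (f x) = f' (φ x) := fun x => by
    have hx : (e x, e (f x)) ∈ Set.range fun x => (e' x, e' (f' x)) := hR ▸ ⟨x, rfl⟩
    obtain ⟨y, hy⟩ := hx
    obtain ⟨h₁, h₂⟩ := Prod.mk.inj hy
    have hy' : y = φ x := he'.injective (h₁.trans (hφ x).symm)
    subst hy'
    exact he'.injective ((hφ _).trans h₂.symm)
  refine ⟨⟨φ.toEquiv, ?_⟩, φ.continuous, φ.symm.continuous⟩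
  intro a b
  rw [hf, hf', inducedGraph_adj, inducedGraph_adj]
  change φ a ≠ φ b ∧ (f' (φ a) = φ b ∨ f' (φ b) = φ a) ↔ _
  rw [← hconj, ← hconj]
  simp

theorem mk_isoClasses_le {B : Set TopGraph} {n : ℕ} (hB : B ⊆ classG n) :
    #(isoClasses B) ≤ 𝔠 := by
  have hcode : ∀ q : isoClasses B,
      ∃ R : {R : Set ((ℕ → unitInterval) × (ℕ → unitInterval)) // IsClosed R},
      ∃ G : TopGraph, Quotient.mk isoSetoid G = q.1 ∧ IsCode G R.1 := by
    rintro ⟨_, G, hG, rfl⟩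
    obtain ⟨R, hR, hGR⟩ := exists_isCode (hB hG)
    exact ⟨⟨R, hR⟩, G, rfl, hGR⟩
  choose R G hG hR using hcode
  have hinj : Function.Injective R := by
    intro p q h
    have hp := hR p
    rw [h] at hp
    exact Subtype.ext ((hG p).symm.trans ((Quotient.sound (hp.isoSetoid_r (hR q))).trans (hG q)))
  have := Cardinal.mk_le_of_injective (f := fun q => ULift.up.{1} (R q))
    (fun _ _ h => hinj (ULift.up.inj h))
  refine this.trans ?_
  rw [Cardinal.mk_uLift, ← Cardinal.lift_continuum.{1, 0}, Cardinal.lift_le]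
  exact mk_isClosed_le_continuum _

/-! ### Three-colorings and the minimum of `classG 3` -/

/-- Colors of the top class of a finite coloring can be replaced by one of the first three. -/
theorem exists_continuous_three_coloring {X : Type} [TopologicalSpace X] (f : X ≃ₜ X) (n : ℕ)
    (c : X → ℕ) (hc : Continuous c) (hp : ∀ x, f x ≠ x → c (f x) ≠ c x)
    (hn : ∀ x, c x < n + 3) :
    ∃ c' : X → ℕ, Continuous c' ∧ (∀ x, f x ≠ x → c' (f x) ≠ c' x) ∧ ∀ x, c' x < 3 := by
  induction n generalizing c with
  | zero => exact ⟨c, hc, hp, by simpa using hn⟩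
  | succ n ih =>
    have hfree : ∀ a b : ℕ, ∃ r, r < 3 ∧ r ≠ a ∧ r ≠ b := by
      intro a b
      by_cases h0 : 0 ≠ a ∧ 0 ≠ b
      · exact ⟨0, by omega, h0⟩
      by_cases h1 : 1 ≠ a ∧ 1 ≠ b
      · exact ⟨1, by omega, h1⟩
      exact ⟨2, by omega, by omega, by omega⟩
    choose r hr₃ hra hrb using hfree
    -- Distinct points of color `n + 3` are never adjacent, so all can be recolored at once, each
    -- avoiding the colors of its two neighbors.
    let g : ℕ × ℕ × ℕ → ℕ := fun t => if t.1 = n + 3 then r t.2.1 t.2.2 else t.1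
    refine ih (fun x => g (c x, c (f x), c (f.symm x))) ?_ ?_ ?_
    · exact (continuous_of_discreteTopology (f := g)).comp
        (hc.prodMk ((hc.comp f.continuous).prodMk (hc.comp f.symm.continuous)))
    · intro x hx
      have h1 := hp x hx
      by_cases ha : c (f x) = n + 3 <;> by_cases hb : c x = n + 3
      · exact absurd (ha.trans hb.symm) h1
      · simpa [g, ha, hb] using hrb (c (f (f x))) (c x)
      · simpa [g, ha, hb] using (hra (c (f x)) (c (f.symm x))).symm
      · simpa [g, ha, hb] using h1
    · intro x
      have := hn x
      simp only [g]
      split_ifs with h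
      · exact (hr₃ _ _).trans_le (by omega)
      · omega

/-- A homeomorphism of a 0DMC space whose fixed points form an open set has a continuous
three-coloring. -/
theorem exists_three_coloring {X : Type} [TopologicalSpace X] (hX : IsZeroDMC X) (f : X ≃ₜ X)
    (hf : ∀ x, f x = x → ∀ᶠ y in 𝓝 x, f y = y) :
    ∃ c : X → Fin 3, Continuous c ∧ ∀ x, f x ≠ x → c (f x) ≠ c x := by
  obtain ⟨h₁, h₂, hbasis⟩ := hX
  have hloc : ∀ x : X, ∃ U : Set X, IsClopen U ∧ x ∈ U ∧ ∀ y ∈ U, f y ≠ y → f y ∉ U := by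
    intro x
    -- Near a fixed point nothing moves and the condition is vacuous; near a moved point a small
    -- clopen set is disjoint from its image.
    by_cases hx : f x = x
    · obtain ⟨U, hU, hxU, hsub⟩ := hbasis.mem_nhds_iff.1 (hf x hx)
      exact ⟨U, hU, hxU, fun y hy hne => absurd (hsub hy) hne⟩
    · obtain ⟨V, W, hV, hW, hxV, hxW, hVW⟩ := t2_separation hx
      obtain ⟨U, hU, hxU, hsub⟩ := hbasis.mem_nhds_iff.1
        (((hV.preimage f.continuous).inter hW).mem_nhds ⟨hxV, hxW⟩)
      exact ⟨U, hU, hxU, fun y hy _ hfy =>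
        Set.disjoint_left.1 hVW (hsub hy).1 (hsub hfy).2⟩
  choose U hU hxU hind using hloc
  obtain ⟨t, ht⟩ := isCompact_univ.elim_finite_subcover U (fun x => (hU x).isOpen)
    (fun x _ => Set.mem_iUnion.2 ⟨x, hxU x⟩)
  -- The color records the first listed set containing the point; 0 is left for uncovered points.
  have hcol : ∀ l : List X, ∃ c : X → ℕ, Continuous c ∧ (∀ x, c x ≤ l.length) ∧
      ∀ x y, (∃ z ∈ l, x ∈ U z) → c x = c y → ∃ z ∈ l, x ∈ U z ∧ y ∈ U z := by
    intro l
    induction l with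
    | nil => exact ⟨fun _ => 0, continuous_const, fun _ => le_rfl, fun x y ⟨z, hz, _⟩ => by simp at hz⟩
    | cons z l ih =>
      obtain ⟨c, hc, hle, h⟩ := ih
      classical
      refine ⟨fun x => if x ∈ U z then l.length + 1 else c x, ?_, ?_, ?_⟩
      · exact continuous_const.if (by simp [(hU z).frontier_eq]) hc
      · intro x
        have := hle x
        simp only [List.length_cons]
        split_ifs <;> omega
      · intro x y hx hxy
        have := hle x
        have := hle y
        by_cases h1 : x ∈ U z <;> by_cases h2 : y ∈ U z <;> simp only [h1, h2, if_true, if_false] at hxy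
        · exact ⟨z, by simp, h1, h2⟩
        · omega
        · omega
        · obtain ⟨w, hw, hxw⟩ := hx
          obtain ⟨w', hw', h'⟩ := h x y ⟨w, (List.mem_cons.1 hw).resolve_left
            (fun e => h1 (e ▸ hxw)), hxw⟩ hxy
          exact ⟨w', List.mem_cons_of_mem _ hw', h'⟩
  obtain ⟨c, hc, hle, hcc⟩ := hcol t.toList
  obtain ⟨c', hc', hp, h3⟩ := exists_continuous_three_coloring f t.toList.length c hc
    (fun x hx he => by
      obtain ⟨z, hz, hxz⟩ := Set.mem_iUnion₂.1 (ht (Set.mem_univ x))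
      obtain ⟨w, -, h1, h2⟩ := hcc x (f x) ⟨z, Finset.mem_toList.2 hz, hxz⟩ he.symm
      exact hind w x h1 hx h2)
    (fun x => (hle x).trans_lt (by omega))
  exact ⟨fun x => ⟨c' x, h3 x⟩, continuous_discrete_rng.2 fun b => by
    convert (isOpen_discrete {(b : ℕ)}).preimage hc' using 1
    ext x
    simp [Fin.ext_iff], fun x hx h => hp x hx (Fin.ext_iff.1 h)⟩

/-- The points `0^∞` and `0^n 1^∞` form a convergent sequence together with its limit. -/
noncomputable def onePointEquiv : OnePoint ℕ ≃ₜ X₁ := by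
  refine (show Continuous (Equiv.ofBijective
    (fun t : OnePoint ℕ => (t.elim ⟨zeroSeq, Or.inl rfl⟩
      fun n => ⟨zeroOneSeq n, Or.inr ⟨n, rfl⟩⟩ : X₁)) ?_) from ?_).homeoOfEquivCompactToT2
  · constructor
    · intro s t h
      have hne : ∀ n, zeroSeq ≠ zeroOneSeq n := fun n h => by
        simpa [zeroSeq, zeroOneSeq] using congrFun h n
      induction s using OnePoint.rec <;> induction t using OnePoint.rec
      · rfl
      · exact absurd (congrArg Subtype.val h) (hne _)
      · exact absurd (congrArg Subtype.val h).symm (hne _)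
      · exact congrArg _ (zeroOneSeq_injective (congrArg Subtype.val h))
    · rintro ⟨_, rfl | ⟨n, rfl⟩⟩
      · exact ⟨OnePoint.infty, rfl⟩
      · exact ⟨n, rfl⟩
  · refine (OnePoint.continuous_iff_from_nat _).2 (tendsto_subtype_rng.2 (tendsto_pi_nhds.2 ?_))
    intro i
    refine tendsto_const_nhds.congr' ?_
    filter_upwards [eventually_gt_atTop i] with n hn
    change (0 : Fin 2) = zeroOneSeq n i
    simp [zeroOneSeq, hn]

theorem onePointEquiv_infty : onePointEquiv OnePoint.infty = ⟨zeroSeq, Or.inl rfl⟩ := rfl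

theorem onePointEquiv_coe (n : ℕ) :
    onePointEquiv (n : OnePoint ℕ) = ⟨zeroOneSeq n, Or.inr ⟨n, rfl⟩⟩ := rfl

theorem flip_flip (m : ℕ) : flip (flip m) = m := by
  unfold flip; split_ifs <;> omega

theorem f₁_onePointEquiv_coe (m : ℕ) :
    f₁ (onePointEquiv (m : OnePoint ℕ)) = onePointEquiv (flip m : ℕ) := by
  have h := f₁_zeroOneSeq (m / 2) (m % 2) (by omega)
  have h1 : 2 * (m / 2) + m % 2 = m := by omega
  have h2 : 2 * (m / 2) + 1 - m % 2 = flip m := by unfold flip; split_ifs <;> omega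
  simp only [h1, h2] at h
  exact h

theorem f₁_onePointEquiv_infty :
    f₁ (onePointEquiv OnePoint.infty) = onePointEquiv OnePoint.infty := f₁_zeroSeq

theorem f₁_involutive : Function.Involutive f₁ := by
  intro x
  obtain ⟨t, rfl⟩ := onePointEquiv.surjective x
  induction t using OnePoint.rec with
  | infty => rw [f₁_onePointEquiv_infty, f₁_onePointEquiv_infty]
  | coe m => rw [f₁_onePointEquiv_coe, f₁_onePointEquiv_coe, flip_flip]

theorem tendsto_onePointEquiv :
    Tendsto (fun n : ℕ => onePointEquiv (n : OnePoint ℕ)) atTop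
      (𝓝 (onePointEquiv OnePoint.infty)) :=
  (OnePoint.continuous_iff_from_nat _).1 onePointEquiv.continuous

theorem continuous_f₁ : Continuous f₁ := by
  suffices h : Continuous (f₁ ∘ onePointEquiv) by
    convert h.comp onePointEquiv.symm.continuous using 1
    ext x
    simp
  refine (OnePoint.continuous_iff_from_nat _).2 ?_
  simp only [Function.comp_def, f₁_onePointEquiv_coe, f₁_onePointEquiv_infty]
  refine tendsto_onePointEquiv.comp (tendsto_atTop_mono (f := fun m => m - 1) (fun m => ?_)
    (tendsto_sub_atTop_nat 1))
  unfold flip; split_ifs <;> omega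

theorem graphX₁_mem_classG : graphX₁ ∈ classG 3 := by
  have : CompactSpace X₁ := onePointEquiv.compactSpace
  refine mem_classG_iff.2 ⟨isZeroDMC_of_totallyDisconnected X₁,
    ⟨⟨f₁_involutive.toPerm, continuous_f₁, continuous_f₁⟩, rfl⟩, fun c hc => ?_⟩
  change X₁ → Fin 3 at c
  change Continuous c at hc
  have h := (hc.tendsto _).comp tendsto_onePointEquiv
  rw [nhds_discrete, tendsto_pure, eventually_atTop] at h
  obtain ⟨N, hN⟩ := h
  refine ⟨onePointEquiv (2 * N : ℕ), onePointEquiv (2 * N + 1 : ℕ), ?_,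
    (hN _ (by omega)).trans (hN _ (by omega)).symm⟩
  refine inducedGraph_adj.2 ⟨?_, Or.inl ?_⟩
  · intro h
    have := OnePoint.coe_injective (onePointEquiv.injective h)
    omega
  · rw [f₁_onePointEquiv_coe, flip, if_pos (by omega)]

/-- Accumulating moved points can be thinned out so that the edges they span are disjoint. -/
theorem exists_seq_disjoint_edges {X : Type} [TopologicalSpace X]
    [TopologicalSpace.MetrizableSpace X] (f : X ≃ₜ X) {x : X} (hx : f x = x)
    (hacc : ∃ᶠ y in 𝓝 x, f y ≠ y) :
    ∃ z : ℕ → X, Tendsto z atTop (𝓝 x) ∧ (∀ n, f (z n) ≠ z n) ∧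
      ∀ m n, m < n → z n ≠ z m ∧ z n ≠ f (z m) ∧ f (z n) ≠ z m := by
  obtain ⟨w, hw, hwf⟩ := exists_seq_forall_of_frequently hacc
  obtain ⟨k, -, hk⟩ := exists_seq_of_forall_finset_exists (fun _ : ℕ => True)
    (fun i j => i < j ∧ w j ≠ w i ∧ w j ≠ f (w i) ∧ f (w j) ≠ w i) (by
      intro s _
      -- Both `w j` and `f (w j)` tend to the fixed point `x`, which differs from the moved points
      -- `w i` and `f (w i)`.
      have : ∀ᶠ j in atTop, ∀ i ∈ s, i < j ∧ w j ≠ w i ∧ w j ≠ f (w i) ∧ f (w j) ≠ w i := by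
        refine (eventually_all_finset s).2 fun i _ => ?_
        have hne : x ≠ w i := fun h => hwf i (h ▸ hx)
        have hne' : x ≠ f (w i) := fun h => hne (f.injective (hx.trans h))
        have hfw : Tendsto (fun j => f (w j)) atTop (𝓝 x) := by
          simpa [hx, Function.comp_def] using (f.continuous.tendsto x).comp hw
        exact (eventually_gt_atTop i).and ((hw.eventually_ne hne).and
          ((hw.eventually_ne hne').and (hfw.eventually_ne hne)))
      obtain ⟨j, hj⟩ := this.exists
      exact ⟨j, trivial, hj⟩)
  have hmono : StrictMono k := strictMono_nat_of_lt_succ fun n => (hk n (n + 1) (by omega)).1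
  exact ⟨w ∘ k, hw.comp hmono.tendsto_atTop, fun n => hwf _, fun m n h => (hk m n h).2⟩

theorem graphX₁_isMinimum : IsMinimumOf LEic (classG 3) graphX₁ := by
  refine ⟨graphX₁_mem_classG, fun G hG => ?_⟩
  obtain ⟨hX, ⟨f, hf⟩, hcol⟩ := mem_classG_iff.1 hG
  have := hX.2.1
  obtain ⟨x, hx, hacc⟩ : ∃ x, f x = x ∧ ∃ᶠ y in 𝓝 x, f y ≠ y := by
    by_contra! hno
    obtain ⟨c, hc, hp⟩ := exists_three_coloring hX f fun x hx => by
      simpa [Filter.Frequently] using hno x hx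
    obtain ⟨a, b, hab, he⟩ := hcol c hc
    rw [hf] at hab
    obtain ⟨hne, rfl | rfl⟩ := inducedGraph_adj.1 hab
    · exact hp a hne.symm he.symm
    · exact hp b hne he
  obtain ⟨z, hz, hzf, hzd⟩ := exists_seq_disjoint_edges f hx hacc
  -- The indices `2j` and `2j + 1`, exchanged by `flip`, carry the two ends of the `j`-th edge.
  let y : ℕ → G.carrier := fun m => if m % 2 = 0 then z (m / 2) else f (z (m / 2))
  have hfz : Tendsto (fun j => f (z j)) atTop (𝓝 x) := by
    simpa [hx, Function.comp_def] using (f.continuous.tendsto x).comp hz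
  have hhalf : Tendsto (fun m : ℕ => m / 2) atTop atTop :=
    Nat.tendsto_div_const_atTop two_ne_zero
  have hy : Tendsto y atTop (𝓝 x) := Tendsto.if' (hz.comp hhalf) (hfz.comp hhalf)
  have hyx : ∀ m, y m ≠ x := by
    intro m
    simp only [y]
    split_ifs
    · exact fun h => hzf (m / 2) (h ▸ hx)
    · exact fun h => hzf (m / 2) (by rw [f.injective (h.trans hx.symm), hx])
  have hlt : ∀ m n, m / 2 < n / 2 → y n ≠ y m := by
    intro m n h
    obtain ⟨h1, h2, h3⟩ := hzd _ _ h
    simp only [y]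
    split_ifs
    · exact h1
    · exact h2
    · exact h3
    · exact fun h => h1 (f.injective h)
  have hadj : ∀ m n, m / 2 = n / 2 → m ≠ n → G.graph.Adj (y m) (y n) := by
    intro m n h hne
    have hz' : G.graph.Adj (z (n / 2)) (f (z (n / 2))) := by
      rw [hf]; exact inducedGraph_adj_apply (hzf _)
    rcases Nat.mod_two_eq_zero_or_one m with h1 | h1 <;>
      rcases Nat.mod_two_eq_zero_or_one n with h2 | h2
    · omega
    · simpa [y, h, h1, h2] using hz'
    · simpa [y, h, h1, h2] using hz'.symm
    · omega
  have hyinj : Function.Injective y := by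
    intro m n h
    by_contra hne
    rcases lt_trichotomy (m / 2) (n / 2) with h1 | h1 | h1
    · exact hlt _ _ h1 h.symm
    · exact (hadj m n h1 hne).ne h
    · exact hlt _ _ h1 h
  let φ : OnePoint ℕ → G.carrier := fun t => t.elim x y
  have hφ : Continuous φ := (OnePoint.continuous_iff_from_nat _).2 hy
  have hφinj : Function.Injective φ := by
    intro s t h
    induction s using OnePoint.rec <;> induction t using OnePoint.rec
    · rfl
    · exact absurd h.symm (hyx _)
    · exact absurd h (hyx _)
    · exact congrArg _ (hyinj h)
  have hstep : ∀ s t, f₁ (onePointEquiv s) = onePointEquiv t → s ≠ t →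
      G.graph.Adj (φ s) (φ t) := by
    intro s t hst hne
    induction s using OnePoint.rec with
    | infty =>
      rw [f₁_onePointEquiv_infty] at hst
      exact absurd (onePointEquiv.injective hst) hne
    | coe m =>
      rw [f₁_onePointEquiv_coe] at hst
      obtain rfl := onePointEquiv.injective hst
      refine hadj m (flip m) ?_ ?_ <;> unfold flip <;> split_ifs <;> omega
  refine ⟨⟨fun p => φ (onePointEquiv.symm p), ?_⟩, hφ.comp onePointEquiv.symm.continuous,
    hφinj.comp onePointEquiv.symm.injective⟩
  intro a b hab
  obtain ⟨s, rfl⟩ := onePointEquiv.surjective a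
  obtain ⟨t, rfl⟩ := onePointEquiv.surjective b
  obtain ⟨hne, h | h⟩ := inducedGraph_adj.1 hab
  · simpa using hstep s t h fun h => hne (h ▸ rfl)
  · simpa using (hstep t s h fun h => hne (h ▸ rfl)).symm

/-! ### Graphs of integer actions -/

/-- The graph induced by the generator of an action of the integers. -/
def orbitGraph (X : Type) [TopologicalSpace X] [AddAction ℤ X] : TopGraph where
  carrier := X
  graph := inducedGraph fun x : X => (1 : ℤ) +ᵥ x

theorem orbitGraph_adj_vadd {X : Type} [TopologicalSpace X] [AddAction ℤ X] {x : X}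
    (h : (1 : ℤ) +ᵥ x ≠ x) :
    (orbitGraph X).graph.Adj x ((1 : ℤ) +ᵥ x : X) :=
  inducedGraph_adj_apply h

theorem orbitGraph_mem_classG {X : Type} [TopologicalSpace X] [AddAction ℤ X]
    [ContinuousConstVAdd ℤ X] (hX : IsZeroDMC X) {n : ℕ}
    (h : ∀ c : X → Fin n, Continuous c → ∃ x, (1 : ℤ) +ᵥ x ≠ x ∧ c x = c ((1 : ℤ) +ᵥ x)) :
    orbitGraph X ∈ classG n := by
  refine mem_classG_iff.2 ⟨hX, ⟨(Homeomorph.vadd (1 : ℤ) : Homeomorph X X), rfl⟩, fun c hc => ?_⟩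
  obtain ⟨x, hx, he⟩ := h c hc
  exact ⟨x, ((1 : ℤ) +ᵥ x : X), orbitGraph_adj_vadd hx, he⟩

/-- An equivariant injective continuous map is a homomorphism. -/
theorem leic_orbitGraph {X Y : Type} [TopologicalSpace X] [AddAction ℤ X] [TopologicalSpace Y]
    [AddAction ℤ Y] {φ : X → Y} (hφ : Continuous φ) (hinj : Function.Injective φ)
    (hequi : ∀ x, φ ((1 : ℤ) +ᵥ x) = (1 : ℤ) +ᵥ φ x) : LEic (orbitGraph X) (orbitGraph Y) := by
  have hhom : ∀ a b : X, (orbitGraph X).graph.Adj a b → (orbitGraph Y).graph.Adj (φ a) (φ b) := by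
    intro a b hab
    obtain ⟨hne, hab⟩ := inducedGraph_adj.1 hab
    exact inducedGraph_adj.2 ⟨hinj.ne hne, hab.imp (fun h => by rw [← hequi, h])
      (fun h => by rw [← hequi, h])⟩
  exact ⟨⟨φ, fun h => hhom _ _ h⟩, hφ, hinj⟩

section Action

variable {X : Type} [AddAction ℤ X]

theorem exists_sign_of_adj {x y : X} (h : (inducedGraph fun x : X => (1 : ℤ) +ᵥ x).Adj x y) :
    ∃ ε : ℤ, (ε = 1 ∨ ε = -1) ∧ y = ε +ᵥ x := by
  obtain ⟨-, h | h⟩ := inducedGraph_adj.1 h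
  · exact ⟨1, Or.inl rfl, h.symm⟩
  · exact ⟨-1, Or.inr rfl, by rw [← h, vadd_vadd, neg_add_cancel, zero_vadd]⟩

theorem one_vadd_ne_of_adj {x y : X} (h : (inducedGraph fun x : X => (1 : ℤ) +ᵥ x).Adj x y) :
    (1 : ℤ) +ᵥ x ≠ x := by
  intro hx
  obtain ⟨hne, h | h⟩ := inducedGraph_adj.1 h
  · exact hne (hx.symm.trans h)
  · exact hne (vadd_left_cancel (1 : ℤ) (hx.trans h.symm))

/-- A walk of length `L` moves its starting point by an integer of the parity of `L` and of
absolute value at most `L`. -/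
theorem exists_displacement {w : ℕ → X}
    (hw : ∀ n, (inducedGraph fun x : X => (1 : ℤ) +ᵥ x).Adj (w n) (w (n + 1))) (L : ℕ) :
    ∃ m : ℤ, |m| ≤ L ∧ (2 : ℤ) ∣ m - L ∧ w L = m +ᵥ w 0 := by
  induction L with
  | zero => exact ⟨0, by simp, by simp, by simp⟩
  | succ L ih =>
    obtain ⟨m, hm, hp, h⟩ := ih
    obtain ⟨ε, hε, h'⟩ := exists_sign_of_adj (hw L)
    refine ⟨ε + m, ?_, ?_, by rw [h', h, vadd_vadd]⟩
    · rw [abs_le] at hm ⊢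
      push_cast
      omega
    · push_cast
      omega

/-- A walk without backtracking moves at constant speed. -/
theorem exists_direction {w : ℕ → X}
    (hw : ∀ n, (inducedGraph fun x : X => (1 : ℤ) +ᵥ x).Adj (w n) (w (n + 1)))
    (hb : ∀ n, w (n + 2) ≠ w n) :
    ∃ ε : ℤ, (ε = 1 ∨ ε = -1) ∧ ∀ n : ℕ, w n = (ε * n) +ᵥ w 0 := by
  obtain ⟨ε, hε, h0⟩ := exists_sign_of_adj (hw 0)
  have hstep : ∀ n, w (n + 1) = ε +ᵥ w n := by
    intro n
    induction n with
    | zero => exact h0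
    | succ n ih =>
      obtain ⟨δ, hδ, h⟩ := exists_sign_of_adj (hw (n + 1))
      obtain rfl | hne := eq_or_ne δ ε
      · exact h
      · have hs : δ + ε = 0 := by omega
        rw [ih, vadd_vadd, hs, zero_vadd] at h
        exact absurd h (hb n)
  refine ⟨ε, hε, fun n => ?_⟩
  induction n with
  | zero => simp
  | succ n ih =>
    rw [hstep, ih, vadd_vadd]
    congr 1
    push_cast
    ring

end Action

/-! ### Odd primes -/

/-- The enumeration of the odd primes. -/
noncomputable def oddPrime (i : ℕ) : ℕ := Nat.nth Nat.Prime (i + 1)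

theorem prime_oddPrime (i : ℕ) : (oddPrime i).Prime := Nat.prime_nth_prime _

theorem oddPrime_strictMono : StrictMono oddPrime := fun _ _ h =>
  Nat.nth_strictMono Nat.infinite_setOfPred_prime (Nat.add_lt_add_right h 1)

theorem two_lt_oddPrime (i : ℕ) : 2 < oddPrime i := by
  rw [← Nat.nth_prime_zero_eq_two]
  exact Nat.nth_strictMono Nat.infinite_setOfPred_prime (Nat.succ_pos i)

theorem odd_oddPrime (i : ℕ) : Odd (oddPrime i) :=
  (prime_oddPrime i).odd_of_ne_two (two_lt_oddPrime i).ne'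

instance (i : ℕ) : NeZero (oddPrime i) := ⟨(prime_oddPrime i).ne_zero⟩

instance (i : ℕ) : Fact (1 < oddPrime i) := ⟨(prime_oddPrime i).one_lt⟩

/-! ### Products of cycles with a fixed point added -/

/-- The product over `i ∈ S` of a cycle of length `oddPrime i` together with a fixed point. -/
def CycleSpace (S : Set ℕ) : Type := ∀ i : S, ZMod (oddPrime i) ⊕ Unit

namespace CycleSpace

variable {S S' : Set ℕ}

noncomputable instance : TopologicalSpace (CycleSpace S) :=
  inferInstanceAs (TopologicalSpace (∀ i : S, ZMod (oddPrime i) ⊕ Unit))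

noncomputable instance : AddAction ℤ (CycleSpace S) where
  vadd m x i := Sum.map (fun a => a + (m : ZMod (oddPrime i))) id (x i)
  zero_vadd x := by
    funext i
    change Sum.map _ _ (x i) = x i
    rcases x i <;> simp
  add_vadd m n x := by
    funext i
    change Sum.map _ _ (x i) = Sum.map _ _ (Sum.map _ _ (x i))
    rcases x i <;> simp [add_comm, add_left_comm]

theorem vadd_apply (m : ℤ) (x : CycleSpace S) (i : S) :
    (m +ᵥ x) i = Sum.map (fun a => a + (m : ZMod (oddPrime i))) id (x i) := rfl

instance : ContinuousConstVAdd ℤ (CycleSpace S) where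
  continuous_const_vadd m := continuous_pi fun i =>
    (continuous_of_discreteTopology (f := Sum.map (fun a => a + (m : ZMod (oddPrime i)))
      (id : Unit → Unit))).comp (continuous_apply i)

theorem continuous_eval (i : S) : Continuous fun x : CycleSpace S => x i := continuous_apply i

theorem isZeroDMC : IsZeroDMC (CycleSpace S) := isZeroDMC_pi fun i : S => ZMod (oddPrime i) ⊕ Unit

/-- The point all whose coordinates are the added fixed points. -/
noncomputable def base (S : Set ℕ) : CycleSpace S := fun _ => Sum.inr ()

theorem vadd_base (m : ℤ) : m +ᵥ base S = base S := rfl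

open Classical in
/-- A point of a single cycle. -/
noncomputable def single (i : S) : CycleSpace S := Function.update (base S) i (Sum.inl 0)

theorem single_self (i : S) : single i i = Sum.inl 0 :=
  Function.update_self (β := fun i : S => ZMod (oddPrime i) ⊕ Unit) i _ _

theorem single_of_ne {i j : S} (h : j ≠ i) : single i j = Sum.inr () :=
  Function.update_of_ne (β := fun i : S => ZMod (oddPrime i) ⊕ Unit) h _ _

theorem vadd_single_ne {m : ℤ} (i : S) (hm : ¬ (oddPrime i : ℤ) ∣ m) :
    m +ᵥ single i ≠ single i := by
  intro h
  have := congrFun h i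
  rw [vadd_apply, single_self] at this
  simp [ZMod.intCast_zmod_eq_zero_iff_dvd, hm] at this

theorem not_oddPrime_dvd {i : ℕ} {m : ℤ} (h0 : m ≠ 0) (h : |m| ≤ 2) : ¬ (oddPrime i : ℤ) ∣ m := by
  intro hd
  have := Int.le_of_dvd (abs_pos.2 h0) ((dvd_abs _ _).2 hd)
  have := two_lt_oddPrime i
  omega

theorem oddPrime_vadd_single (i : S) : ((oddPrime i : ℕ) : ℤ) +ᵥ single i = single i := by
  funext j
  rw [vadd_apply]
  obtain rfl | hne := eq_or_ne j i
  · simp [single_self]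
  · simp [single_of_ne hne]

/-- A point that is not fixed has a coordinate on a genuine cycle, and `m` must be a multiple of
that cycle's length. -/
theorem exists_dvd_of_vadd_eq {m : ℤ} {x : CycleSpace S} (hm : m +ᵥ x = x)
    (hx : (1 : ℤ) +ᵥ x ≠ x) : ∃ i : S, (oddPrime i : ℤ) ∣ m := by
  by_contra! hno
  refine hx (funext fun i => ?_)
  have h := congrFun hm i
  rw [vadd_apply] at h ⊢
  cases hxi : x i with
  | inl a =>
    rw [hxi] at h
    simp [ZMod.intCast_zmod_eq_zero_iff_dvd, hno i] at h
  | inr u => rfl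

theorem tendsto_single : Tendsto (single (S := S)) cofinite (𝓝 (base S)) := by
  refine tendsto_pi_nhds.2 fun j => tendsto_const_nhds.congr' ?_
  filter_upwards [(Set.finite_singleton j).compl_mem_cofinite] with i hi
  exact (single_of_ne (Ne.symm hi)).symm

/-- The single cycles shrink to the fixed point `base S`, near which a continuous coloring is
constant. -/
theorem orbitGraph_mem_classG (hS : S.Infinite) : orbitGraph (CycleSpace S) ∈ classG 3 := by
  refine TopGraph.orbitGraph_mem_classG isZeroDMC fun c hc => ?_
  have : Infinite S := hS.to_subtype
  have h1 := (hc.tendsto _).comp (tendsto_single (S := S))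
  have h2 := ((hc.comp (continuous_const_vadd (1 : ℤ))).tendsto _).comp (tendsto_single (S := S))
  simp only [nhds_discrete, tendsto_pure, Function.comp_def, vadd_base] at h1 h2
  obtain ⟨i, hi1, hi2⟩ := (h1.and h2).exists
  exact ⟨single i, vadd_single_ne i (not_oddPrime_dvd one_ne_zero (by norm_num)),
    hi1.trans hi2.symm⟩

theorem leic_of_subset (h : S ⊆ S') : LEic (orbitGraph (CycleSpace S)) (orbitGraph (CycleSpace S')) := by
  classical
  let φ : CycleSpace S → CycleSpace S' := fun x i => if hi : i.1 ∈ S then x ⟨i, hi⟩ else Sum.inr ()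
  have hφ : Continuous φ := by
    refine continuous_pi fun i => ?_
    by_cases hi : i.1 ∈ S
    · simpa [φ, hi] using continuous_eval (⟨i, hi⟩ : S)
    · simpa [φ, hi] using continuous_const
  have hinj : Function.Injective φ := by
    intro x y hxy
    funext i
    have := congrFun hxy ⟨i, h i.2⟩
    simpa [φ] using this
  have hequi : ∀ x, φ ((1 : ℤ) +ᵥ x) = (1 : ℤ) +ᵥ φ x := by
    intro x
    funext i
    rw [vadd_apply]
    by_cases hi : i.1 ∈ S
    · simp [φ, hi, vadd_apply]
    · simp [φ, hi]
  exact leic_orbitGraph hφ hinj hequi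

theorem adj_vadd_single (i : S) (n : ℕ) : (orbitGraph (CycleSpace S)).graph.Adj
    ((n : ℤ) +ᵥ (single i : CycleSpace S)) (((n + 1 : ℕ) : ℤ) +ᵥ (single i : CycleSpace S)) := by
  rw [Nat.cast_succ, add_comm, add_vadd]
  refine orbitGraph_adj_vadd fun h => ?_
  rw [vadd_vadd, add_comm, add_vadd] at h
  exact vadd_single_ne i (not_oddPrime_dvd one_ne_zero (by norm_num)) (vadd_left_cancel _ h)

/-- The injective image of a prime cycle cannot backtrack, so it returns after that many steps in
one direction; a prime of `S'` then divides the length, hence equals it. -/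
theorem subset_of_leic (h : LEic (orbitGraph (CycleSpace S)) (orbitGraph (CycleSpace S'))) :
    S ⊆ S' := by
  obtain ⟨φ, -, hinj⟩ := h
  intro i hi
  let w : ℕ → CycleSpace S' := fun n => φ ((n : ℤ) +ᵥ (single ⟨i, hi⟩ : CycleSpace S))
  have hw : ∀ n, (inducedGraph fun x : CycleSpace S' => (1 : ℤ) +ᵥ x).Adj (w n) (w (n + 1)) :=
    fun n => φ.map_rel (adj_vadd_single ⟨i, hi⟩ n)
  obtain ⟨ε, hε, hdir⟩ := exists_direction hw fun n heq => by
    have := hinj heq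
    rw [Nat.cast_add, add_vadd] at this
    exact vadd_single_ne ⟨i, hi⟩ (not_oddPrime_dvd (by norm_num) (by norm_num))
      (vadd_left_cancel _ this)
  have hper : w (oddPrime i) = w 0 := by
    simp only [w]
    rw [oddPrime_vadd_single ⟨i, hi⟩, Nat.cast_zero, zero_vadd]
  obtain ⟨j, hj⟩ := exists_dvd_of_vadd_eq ((hdir _).symm.trans hper) (one_vadd_ne_of_adj (hw 0))
  have hd : (oddPrime j : ℤ) ∣ oddPrime i := by
    rcases hε with rfl | rfl <;> simpa using hj
  have := (Nat.prime_dvd_prime_iff_eq (prime_oddPrime _) (prime_oddPrime _)).1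
    (Int.natCast_dvd_natCast.1 hd)
  exact oddPrime_strictMono.injective this ▸ j.2

/-- Even with backtracking, a closed walk of odd length has odd, hence nonzero, displacement, no
larger than its length. Primes exceeding that length cannot divide it. -/
theorem not_lec_of_lt {i : ℕ} (hi : i ∈ S) (hS' : ∀ j ∈ S', i < j) :
    ¬ LEc (orbitGraph (CycleSpace S)) (orbitGraph (CycleSpace S')) := by
  rintro ⟨φ, -⟩
  let w : ℕ → CycleSpace S' := fun n => φ ((n : ℤ) +ᵥ (single ⟨i, hi⟩ : CycleSpace S))
  have hw : ∀ n, (inducedGraph fun x : CycleSpace S' => (1 : ℤ) +ᵥ x).Adj (w n) (w (n + 1)) :=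
    fun n => φ.map_rel (adj_vadd_single ⟨i, hi⟩ n)
  obtain ⟨m, hm, hpar, hdisp⟩ := exists_displacement hw (oddPrime i)
  have hper : w (oddPrime i) = w 0 := by
    simp only [w]
    rw [oddPrime_vadd_single ⟨i, hi⟩, Nat.cast_zero, zero_vadd]
  obtain ⟨j, hj⟩ := exists_dvd_of_vadd_eq (hdisp.symm.trans hper) (one_vadd_ne_of_adj (hw 0))
  have hlt := oddPrime_strictMono (hS' j j.2)
  obtain ⟨r, hr⟩ := odd_oddPrime i
  have h0 : m ≠ 0 := by
    rintro rfl
    omega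
  have := Int.le_of_dvd (abs_pos.2 h0) ((dvd_abs _ _).2 hj)
  omega

end CycleSpace

/-! ### Odometers -/

/-- The product of the rings `ZMod (p ^ k)`, where `p = oddPrime i` with `i ∈ S` and `k ∈ ℕ`. -/
def Odometer (S : Set ℕ) : Type := ∀ j : S × ℕ, ZMod (oddPrime j.1 ^ j.2)

namespace Odometer

variable {S S' : Set ℕ}

noncomputable instance : TopologicalSpace (Odometer S) :=
  inferInstanceAs (TopologicalSpace (∀ j : S × ℕ, ZMod (oddPrime j.1 ^ j.2)))

noncomputable instance : CommRing (Odometer S) :=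
  inferInstanceAs (CommRing (∀ j : S × ℕ, ZMod (oddPrime j.1 ^ j.2)))

instance : IsTopologicalRing (Odometer S) :=
  inferInstanceAs (IsTopologicalRing (∀ j : S × ℕ, ZMod (oddPrime j.1 ^ j.2)))

instance : CompactSpace (Odometer S) :=
  inferInstanceAs (CompactSpace (∀ j : S × ℕ, ZMod (oddPrime j.1 ^ j.2)))

instance : T2Space (Odometer S) :=
  inferInstanceAs (T2Space (∀ j : S × ℕ, ZMod (oddPrime j.1 ^ j.2)))

noncomputable instance : AddAction ℤ (Odometer S) where
  vadd m x := x + (m : Odometer S)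
  zero_vadd x := by
    change x + ((0 : ℤ) : Odometer S) = x
    simp
  add_vadd m n x := by
    change x + ((m + n : ℤ) : Odometer S) = x + (n : Odometer S) + (m : Odometer S)
    push_cast
    ring

theorem vadd_eq (m : ℤ) (x : Odometer S) : m +ᵥ x = x + (m : Odometer S) := rfl

instance : ContinuousConstVAdd ℤ (Odometer S) where
  continuous_const_vadd _ := continuous_id.add continuous_const

/-- The coordinate projections. -/
noncomputable def coord (i : S) (k : ℕ) : Odometer S →+* ZMod (oddPrime i ^ k) :=
  Pi.evalRingHom (fun j : S × ℕ => ZMod (oddPrime j.1 ^ j.2)) (i, k)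

theorem continuous_coord (i : S) (k : ℕ) : Continuous (coord i k) :=
  continuous_apply (A := fun j : S × ℕ => ZMod (oddPrime j.1 ^ j.2)) (i, k)

theorem isZeroDMC : IsZeroDMC (Odometer S) :=
  isZeroDMC_pi fun j : S × ℕ => ZMod (oddPrime j.1 ^ j.2)

open Classical in
/-- A sequence of natural numbers converging to zero in `Odometer S`. -/
noncomputable def tower (S : Set ℕ) (n : ℕ) : ℕ := ∏ i ∈ Finset.range n with i ∈ S, oddPrime i ^ n

theorem odd_tower (n : ℕ) : Odd (tower S n) :=
  Finset.prod_induction _ Odd (fun _ _ => Odd.mul) odd_one fun i _ => (odd_oddPrime i).pow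

theorem coprime_tower {k : ℕ} (hk : k ∉ S) (n : ℕ) : (oddPrime k).Coprime (tower S n) := by
  classical
  refine Nat.Coprime.prod_right fun i hi => Nat.Coprime.pow_right _ ?_
  refine (Nat.coprime_primes (prime_oddPrime k) (prime_oddPrime i)).2 fun h => hk ?_
  rw [oddPrime_strictMono.injective h]
  exact (Finset.mem_filter.1 hi).2

theorem tendsto_tower : Tendsto (fun n => (tower S n : Odometer S)) atTop (𝓝 0) := by
  classical
  refine tendsto_pi_nhds.2 fun j => tendsto_const_nhds.congr' ?_
  filter_upwards [eventually_gt_atTop (j.1 : ℕ), eventually_ge_atTop j.2] with n h1 h2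
  have hd : oddPrime j.1 ^ j.2 ∣ tower S n :=
    (pow_dvd_pow _ h2).trans (Finset.dvd_prod_of_mem (fun i => oddPrime i ^ n)
      (Finset.mem_filter.2 ⟨Finset.mem_range.2 h1, j.1.2⟩))
  have h : coord j.1 j.2 (tower S n : Odometer S) = 0 := by
    rw [map_natCast, ZMod.natCast_eq_zero_iff]
    exact hd
  exact h.symm

theorem eventually_eq_of_continuous {D : Type} [TopologicalSpace D] [DiscreteTopology D]
    {c : Odometer S → D} (hc : Continuous c) {v : ℕ → Odometer S} (hv : Tendsto v atTop (𝓝 0)) :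
    ∀ᶠ n in atTop, c (v n) = c 0 := by
  have := (hc.tendsto 0).comp hv
  rwa [nhds_discrete, tendsto_pure] at this

/-- By compactness a locally constant map is invariant under all sufficiently small translations. -/
theorem eventually_forall_add_tower_eq {D : Type} [TopologicalSpace D] [DiscreteTopology D]
    {c : Odometer S → D} (hc : Continuous c) :
    ∀ᶠ n in atTop, ∀ x, c (x + (tower S n : Odometer S)) = c x := by
  have h : ∀ᶠ v : Odometer S in 𝓝 0, ∀ x ∈ (Set.univ : Set (Odometer S)), c (x + v) = c x := by
    refine isCompact_univ.eventually_forall_of_forall_eventually fun x _ => ?_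
    have hcont : Continuous fun z : Odometer S × Odometer S => (c (z.2 + z.1), c z.2) :=
      (hc.comp (continuous_snd.add continuous_fst)).prodMk (hc.comp continuous_snd)
    exact ((isOpen_discrete {t : D × D | t.1 = t.2}).preimage hcont).mem_nhds (by simp)
  exact (tendsto_tower.eventually h).mono fun n hn x => hn x trivial

/-- Thus a single coordinate tells forward steps from backward ones, which makes the direction of an
edge a continuous datum. -/
theorem one_ne_neg_one (i : S) : (1 : ZMod (oddPrime i ^ 1)) ≠ -1 := by
  intro h
  have h2 : ((2 : ℕ) : ZMod (oddPrime i ^ 1)) = 0 := by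
    push_cast
    linear_combination h
  rw [ZMod.natCast_eq_zero_iff, pow_one] at h2
  exact absurd (Nat.le_of_dvd two_pos h2) (not_le.2 (two_lt_oddPrime i))

theorem one_vadd_ne (hS : S.Nonempty) (x : Odometer S) : (1 : ℤ) +ᵥ x ≠ x := by
  obtain ⟨i, hi⟩ := hS
  intro h
  have h1 : (1 : Odometer S) = 0 := by simpa [vadd_eq] using h
  have h2 : (1 : ZMod (oddPrime i ^ 1)) = 0 := by simpa using congrArg (coord ⟨i, hi⟩ 1) h1
  exact one_ne_neg_one (⟨i, hi⟩ : S) (by rw [h2, neg_zero])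

theorem adj_add_one (hS : S.Nonempty) (x : Odometer S) :
    (orbitGraph (Odometer S)).graph.Adj x (x + 1) := by
  have := orbitGraph_adj_vadd (one_vadd_ne hS x)
  rwa [vadd_eq, Int.cast_one] at this

/-- A 2-coloring alternates along the natural numbers, yet the odd numbers `tower S n` tend to 0 and
would eventually share its color. -/
theorem orbitGraph_mem_classG (hS : S.Nonempty) : orbitGraph (Odometer S) ∈ classG 2 := by
  refine TopGraph.orbitGraph_mem_classG isZeroDMC fun c hc => ?_
  by_contra! hno
  have halt : ∀ n : ℕ, c n = c 0 ↔ Even n := by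
    intro n
    induction n with
    | zero => simp
    | succ n ih =>
      have hne := hno _ (one_vadd_ne hS (n : Odometer S))
      rw [vadd_eq, Int.cast_one] at hne
      rw [Nat.even_add_one, ← ih, Nat.cast_succ]
      omega
  obtain ⟨n, hn⟩ := (eventually_eq_of_continuous hc tendsto_tower).exists
  exact (Nat.not_even_iff_odd.2 (odd_tower n)) ((halt _).1 hn)

/-- A homomorphism between odometers is possible only if the primes of the target are among those
of the source. -/
theorem subset_of_lec (hS : S.Nonempty) (h : LEc (orbitGraph (Odometer S)) (orbitGraph (Odometer S'))) :
    S' ⊆ S := by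
  obtain ⟨φ', hφ'⟩ := h
  intro k hk'
  by_contra hk
  obtain ⟨φ, hφ, hadj⟩ : ∃ φ : Odometer S → Odometer S', Continuous φ ∧
      ∀ x, (inducedGraph fun x : Odometer S' => (1 : ℤ) +ᵥ x).Adj (φ x) (φ (x + 1)) :=
    ⟨φ', hφ', fun x => φ'.map_rel (adj_add_one hS x)⟩
  clear φ' hφ'
  set k' : S' := ⟨k, hk'⟩
  let s : Odometer S → ℤ := fun x =>
    if coord k' 1 (φ (x + 1)) = coord k' 1 (φ x) + 1 then 1 else -1
  have hs : Continuous s := by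
    let g : ZMod (oddPrime k' ^ 1) × ZMod (oddPrime k' ^ 1) → ℤ := fun t =>
      if t.1 = t.2 + 1 then 1 else -1
    have hcc := (continuous_coord k' 1).comp hφ
    exact (continuous_of_discreteTopology (f := g)).comp
      ((hcc.comp (continuous_id.add continuous_const)).prodMk hcc)
  have hs1 : ∀ x, s x = 1 ∨ s x = -1 := by
    intro x
    simp only [s]
    split_ifs <;> simp
  have hstep : ∀ x, φ (x + 1) = φ x + (s x : Odometer S') := by
    intro x
    obtain ⟨ε, hε | hε, h⟩ := exists_sign_of_adj (hadj x) <;> subst hε <;> rw [vadd_eq] at h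
    · have : s x = 1 := if_pos (by rw [h]; simp)
      rw [h, this]
    · have : s x = -1 := if_neg (by
        rw [h]
        simpa using (one_ne_neg_one k').symm)
      rw [h, this]
  let σ : ℕ → ℤ := fun n => ∑ i ∈ Finset.range n, s i
  have hσ : ∀ n : ℕ, φ n = φ 0 + (σ n : Odometer S') := by
    intro n
    induction n with
    | zero => simp [σ]
    | succ n ih =>
      rw [Nat.cast_succ, hstep, ih]
      simp only [σ, Finset.sum_range_succ]
      push_cast
      ring
  obtain ⟨l, hl⟩ := (eventually_forall_add_tower_eq hs).exists
  set N := tower S l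
  -- The direction `s` is invariant under translation by `N`, so each block of `N` steps has the
  -- same drift.
  have hmul : ∀ n : ℕ, σ (N * n) = σ N * n := by
    have hper : ∀ n m : ℕ, s ((N * n + m : ℕ) : Odometer S) = s m := by
      intro n m
      induction n with
      | zero => simp
      | succ n ih =>
        rw [← ih, ← hl ((N * n + m : ℕ) : Odometer S)]
        congr 1
        push_cast
        ring
    intro n
    induction n with
    | zero => simp [σ]
    | succ n ih =>
      have : σ (N * (n + 1)) = σ (N * n) + σ N := by
        simp only [σ, Nat.mul_succ, Finset.sum_range_add]
        simp only [hper]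
      rw [this, ih]
      push_cast
      ring
  have hpar : ∀ n : ℕ, (2 : ℤ) ∣ σ n - n := by
    intro n
    induction n with
    | zero => simp [σ]
    | succ n ih =>
      have := hs1 n
      have hsucc : σ (n + 1) = σ n + s n := Finset.sum_range_succ _ _
      rw [hsucc]
      push_cast
      omega
  -- As `N * tower S n` tends to 0, the drift `σ N * tower S n` vanishes modulo each power of
  -- `oddPrime k` for some `n`, and `tower S n` is coprime to that prime.
  have hdvd : ∀ e : ℕ, oddPrime k ^ e ∣ (σ N).natAbs := by
    intro e
    have htend : Tendsto (fun n => (N : Odometer S) * (tower S n : Odometer S)) atTop (𝓝 0) := by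
      simpa using tendsto_tower.const_mul (N : Odometer S)
    obtain ⟨n, hn⟩ := (eventually_eq_of_continuous ((continuous_coord k' e).comp hφ) htend).exists
    simp only [Function.comp_apply] at hn
    rw [← Nat.cast_mul, hσ, hmul, map_add, add_eq_left, map_intCast,
      ZMod.intCast_zmod_eq_zero_iff_dvd, Int.natCast_dvd, Int.natAbs_mul, Int.natAbs_natCast] at hn
    exact (Nat.Coprime.pow_left e (coprime_tower hk n)).dvd_of_dvd_mul_right hn
  have hne : (σ N).natAbs ≠ 0 := by
    intro h
    obtain ⟨r, hr⟩ : Odd N := odd_tower l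
    have := hpar N
    omega
  exact absurd (Nat.le_of_dvd (Nat.pos_of_ne_zero hne) (hdvd (σ N).natAbs))
    (not_le.2 (Nat.lt_pow_self (prime_oddPrime k).one_lt))

/-- An element of `classG 2` mapping injectively to an odometer has an orbit of more than two
points. -/
theorem exists_apply_apply_ne {G : TopGraph} (hG : G ∈ classG 2) (hS : S.Nonempty)
    (h : LEic G (orbitGraph (Odometer S))) (f : G.carrier ≃ₜ G.carrier)
    (hf : G.graph = inducedGraph f) : ∃ x, f (f x) ≠ x := by
  obtain ⟨φ', hφ', -⟩ := h
  obtain ⟨φ, hφ, hadj⟩ : ∃ φ : G.carrier → Odometer S, Continuous φ ∧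
      ∀ x, f x ≠ x → (inducedGraph fun x : Odometer S => (1 : ℤ) +ᵥ x).Adj (φ x) (φ (f x)) :=
    ⟨φ', hφ', fun x hx => φ'.map_rel (by rw [hf]; exact inducedGraph_adj_apply hx)⟩
  clear φ' hφ'
  by_contra! hinv
  obtain ⟨i, hi⟩ := hS
  set k : S := ⟨i, hi⟩
  -- For an involution, the steps from the two ends of an edge are opposite, so the direction of the
  -- step is a 2-coloring.
  let g : ZMod (oddPrime k ^ 1) × ZMod (oddPrime k ^ 1) → Fin 2 := fun t =>
    if t.1 = t.2 + 1 then 1 else 0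
  have hcc := (continuous_coord k 1).comp hφ
  obtain ⟨x, y, hxy, hc⟩ := (mem_classG_iff.1 hG).2.2
    (fun x => g (coord k 1 (φ (f x)), coord k 1 (φ x)))
    ((continuous_of_discreteTopology (f := g)).comp ((hcc.comp f.continuous).prodMk hcc))
  obtain ⟨x, hx, hc⟩ : ∃ x, f x ≠ x ∧ g (coord k 1 (φ (f x)), coord k 1 (φ x)) =
      g (coord k 1 (φ (f (f x))), coord k 1 (φ (f x))) := by
    rw [hf] at hxy
    obtain ⟨hne, rfl | rfl⟩ := inducedGraph_adj.1 hxy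
    · exact ⟨x, hne.symm, hc⟩
    · exact ⟨y, hne, hc.symm⟩
  rw [hinv] at hc
  have h1 := one_ne_neg_one k
  obtain ⟨ε, hε | hε, h⟩ := exists_sign_of_adj (hadj x hx) <;> subst hε <;>
    rw [vadd_eq] at h <;> rw [h] at hc
  · have : ¬ (1 : ZMod (oddPrime k ^ 1)) + 1 = 0 := fun h => h1 (eq_neg_of_add_eq_zero_left h)
    simp [g, add_assoc, this] at hc
  · simp [g, h1.symm] at hc

/-- An injective homomorphism to an odometer is equivariant up to orientation along orbits of
more than two points. -/
theorem exists_orientation {X : Type} (f : X ≃ X) {φ : X → Odometer S}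
    (hinj : Function.Injective φ)
    (hadj : ∀ x, f x ≠ x → (inducedGraph fun x : Odometer S => (1 : ℤ) +ᵥ x).Adj (φ x) (φ (f x)))
    {x : X} (hx : f (f x) ≠ x) :
    ∃ ε : ℤ, (ε = 1 ∨ ε = -1) ∧ ∀ n : ℕ, φ (f^[n] x) = φ x + ((ε * n : ℤ) : Odometer S) := by
  have hx1 : f x ≠ x := fun h => hx (by rw [h, h])
  have hit : ∀ n, Function.Injective f^[n] := fun n => f.injective.iterate n
  refine exists_direction (w := fun n => φ (f^[n] x)) (fun n => ?_) fun n h => ?_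
  · simp only [Function.iterate_succ_apply']
    refine hadj _ fun h => hx1 (hit n ?_)
    rwa [← Function.iterate_succ_apply, Function.iterate_succ_apply']
  · refine hx (hit n ?_)
    have := hinj h
    rwa [Function.iterate_add_apply] at this

/-- Odometers above a common element of `classG 2` have the same primes. -/
theorem subset_of_common_leic {G : TopGraph} (hG : G ∈ classG 2) (hS : S.Nonempty)
    (h : LEic G (orbitGraph (Odometer S))) (h' : LEic G (orbitGraph (Odometer S'))) : S' ⊆ S := by
  have := hG.1.1
  obtain ⟨f, hf⟩ := hG.2.1
  obtain ⟨x, hx⟩ := exists_apply_apply_ne hG hS h f hf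
  have hadj : ∀ x, f x ≠ x → G.graph.Adj x (f x) := fun x hx => by
    rw [hf]; exact inducedGraph_adj_apply hx
  obtain ⟨φ, hφ, hinj⟩ := h
  obtain ⟨ψ, hψ, hinj'⟩ := h'
  obtain ⟨ε, hε, h⟩ := exists_orientation (S := S) f.toEquiv hinj
    (fun x hx => φ.map_rel (hadj x hx)) hx
  obtain ⟨δ, hδ, h'⟩ := exists_orientation (S := S') f.toEquiv hinj'
    (fun x hx => ψ.map_rel (hadj x hx)) hx
  intro k hk'
  by_contra hk
  obtain ⟨φ, hφ, hinj, h⟩ : ∃ φ : G.carrier → Odometer S, Continuous φ ∧ Function.Injective φ ∧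
      ∀ n : ℕ, φ (f^[n] x) = φ x + ((ε * n : ℤ) : Odometer S) := ⟨φ, hφ, hinj, h⟩
  obtain ⟨ψ, hψ, h'⟩ : ∃ ψ : G.carrier → Odometer S', Continuous ψ ∧
      ∀ n : ℕ, ψ (f^[n] x) = ψ x + ((δ * n : ℤ) : Odometer S') := ⟨ψ, hψ, h'⟩
  -- By compactness `φ` is an embedding, so recurrence in the odometer of `S` pulls back to `x`; `ψ`
  -- then carries it to the odometer of `S'`.
  have hret : Tendsto (fun n => f^[tower S n] x) atTop (𝓝 x) := by
    rw [(hφ.isClosedEmbedding hinj).isEmbedding.tendsto_nhds_iff]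
    have : Tendsto (fun n => φ x + (ε : Odometer S) * (tower S n : Odometer S)) atTop
        (𝓝 (φ x + ε * 0)) := tendsto_const_nhds.add (tendsto_tower.const_mul _)
    simpa [Function.comp_def, h] using this
  have hev := ((((continuous_coord (⟨k, hk'⟩ : S') 1).comp hψ).tendsto x).comp hret)
  rw [nhds_discrete, tendsto_pure] at hev
  obtain ⟨n, hn⟩ := hev.exists
  simp only [Function.comp_apply, h', map_add, add_eq_left, map_intCast,
    ZMod.intCast_zmod_eq_zero_iff_dvd, pow_one] at hn
  have hd : (oddPrime k : ℤ) ∣ tower S n := by rcases hδ with rfl | rfl <;> simpa using hn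
  exact (prime_oddPrime k).one_lt.ne'
    (Nat.Coprime.eq_one_of_dvd (coprime_tower hk n) (Int.natCast_dvd_natCast.1 hd))

end Odometer

/-! ### Families of size continuum and the theorem -/

/-- A family of infinite sets none of which contains another. -/
def twinSet (A : Set ℕ) : Set ℕ := {m | m % 2 = 0 ∧ m / 2 ∈ A ∨ m % 2 = 1 ∧ m / 2 ∉ A}

theorem twinSet_infinite (A : Set ℕ) : (twinSet A).Infinite := by
  refine Set.infinite_of_forall_exists_gt fun n => ?_
  by_cases h : n + 1 ∈ A
  · exact ⟨2 * (n + 1), Or.inl ⟨by omega, by convert h using 1; omega⟩, by omega⟩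
  · exact ⟨2 * (n + 1) + 1, Or.inr ⟨by omega, by convert h using 2; omega⟩, by omega⟩

/-- Even members encode the set and odd members its complement, so one inclusion gives both. -/
theorem eq_of_twinSet_subset {A A' : Set ℕ} (h : twinSet A ⊆ twinSet A') : A = A' := by
  have key : ∀ n, (n ∈ A → n ∈ A') ∧ (n ∉ A → n ∉ A') := by
    intro n
    have e0 : 2 * n / 2 = n := by omega
    have e1 : (2 * n + 1) / 2 = n := by omega
    have h0 := @h (2 * n)
    have h1 := @h (2 * n + 1)
    simp only [twinSet, Set.mem_ofPred_eq, e0, e1] at h0 h1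
    constructor
    · intro hn
      rcases h0 (Or.inl ⟨by omega, hn⟩) with h | h
      · exact h.2
      · omega
    · intro hn
      rcases h1 (Or.inr ⟨by omega, hn⟩) with h | h
      · omega
      · exact h.2
  ext n
  have := key n
  tauto

/-- A family indexed by sets of natural numbers and separated by `r` is an antichain of size
continuum. -/
theorem exists_antichain {r : TopGraph → TopGraph → Prop} (hr : ∀ G, r G G) {Γ : Set TopGraph}
    (F : Set ℕ → TopGraph) (hF : ∀ A, F A ∈ Γ) (h : ∀ A A', r (F A) (F A') → A = A') :
    ∃ A ⊆ Γ, #A = 𝔠 ∧ IsAntichain r A := by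
  have hinj : Function.Injective F := fun A A' he => h A A' (he ▸ hr _)
  refine ⟨Set.range F, Set.range_subset_iff.2 hF, ?_, ?_⟩
  · have := Cardinal.mk_range_eq_of_injective hinj
    rw [Cardinal.lift_uzero, Cardinal.mk_set_nat, Cardinal.lift_continuum] at this
    exact this
  · rintro _ ⟨A, rfl⟩ _ ⟨A', rfl⟩ hne hr'
    exact hne (congrArg F (h _ _ hr'))

/-- Isomorphic basis elements chosen below two odometers would give these a common lower bound. -/
theorem mk_isoClasses_of_isBasis {B : Set TopGraph} (hB : IsBasisOf LEic (classG 2) B) :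
    𝔠 ≤ #(isoClasses B) := by
  have hne : ∀ A, (twinSet A).Nonempty := fun A => (twinSet_infinite A).nonempty
  choose b hb hle using fun A => hB.2 _ (Odometer.orbitGraph_mem_classG (hne A))
  have hinj : Function.Injective fun A : Set ℕ =>
      (⟨Quotient.mk isoSetoid (b A), b A, hb A, rfl⟩ : isoClasses B) := by
    intro A A' h
    obtain ⟨φ, hφ, -⟩ := Quotient.exact (congrArg Subtype.val h)
    have hle' : LEic (b A) (b A') := ⟨φ.toHom, hφ, φ.injective⟩
    exact (eq_of_twinSet_subset (Odometer.subset_of_common_leic (hB.1 (hb A)) (hne A) (hle A)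
      (hle'.trans (hle A')))).symm
  have := Cardinal.lift_mk_le_lift_mk_of_injective hinj
  rwa [Cardinal.mk_set_nat, Cardinal.lift_continuum, Cardinal.lift_uzero] at this

/-- One chain serves both quasi-orders: it descends by injective maps, and no step can be reversed
even by a non-injective one. -/
theorem not_wellFoundedOn_of_lec {κ : ℕ} (hκ : κ ≤ 3) {r : TopGraph → TopGraph → Prop}
    (h₁ : ∀ {G H}, LEic G H → r G H) (h₂ : ∀ {G H}, r G H → LEc G H) :
    ¬ (classG κ).WellFoundedOn (strictPart r) := by
  intro h
  let F : ℕ → classG κ := fun n => ⟨orbitGraph (CycleSpace (Set.Ici n)),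
    classG_anti hκ (CycleSpace.orbitGraph_mem_classG (Set.Ici_infinite n))⟩
  refine (wellFounded_iff_isEmpty_descending_chain.1 h).false ⟨F, fun n => ⟨h₁ ?_, fun hle => ?_⟩⟩
  · exact CycleSpace.leic_of_subset (Set.Ici_subset_Ici.2 (Nat.le_succ n))
  · exact CycleSpace.not_lec_of_lt (Set.mem_Ici.2 le_rfl) (fun j hj => Nat.lt_of_succ_le hj)
      (h₂ hle)

end TopGraph

theorem theorem1p11 :
    TopGraph.IsMinimumOf TopGraph.LEic (TopGraph.classG 0) TopGraph.onePoint ∧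
    TopGraph.IsMinimumOf TopGraph.LEic (TopGraph.classG 1) TopGraph.twoPoint ∧
    (∀ B : Set TopGraph, TopGraph.IsBasisOf TopGraph.LEic (TopGraph.classG 2) B →
      𝔠 ≤ Cardinal.mk B ∧ Cardinal.mk (TopGraph.isoClasses B) = 𝔠) ∧
    TopGraph.IsMinimumOf TopGraph.LEic (TopGraph.classG 3) TopGraph.graphX₁ ∧
    (∀ κ : ℕ, κ ≤ 3 →
      ¬ (TopGraph.classG κ).WellFoundedOn (TopGraph.strictPart TopGraph.LEic) ∧
      ¬ (TopGraph.classG κ).WellFoundedOn (TopGraph.strictPart TopGraph.LEc)) ∧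
    (∀ κ : ℕ, κ ≤ 3 →
      ∃ A ⊆ TopGraph.classG κ, Cardinal.mk A = 𝔠 ∧ IsAntichain TopGraph.LEic A) ∧
    (∀ κ : ℕ, κ ≤ 3 → κ ≠ 3 →
      ∃ A ⊆ TopGraph.classG κ, Cardinal.mk A = 𝔠 ∧ IsAntichain TopGraph.LEc A) := by
  refine ⟨TopGraph.onePoint_isMinimum, TopGraph.twoPoint_isMinimum, fun B hB => ?_,
    TopGraph.graphX₁_isMinimum, fun κ hκ => ⟨?_, ?_⟩, fun κ hκ => ?_, fun κ hκ hne => ?_⟩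
  · have h := TopGraph.mk_isoClasses_of_isBasis hB
    exact ⟨h.trans Cardinal.mk_image_le, (TopGraph.mk_isoClasses_le hB.1).antisymm h⟩
  · exact TopGraph.not_wellFoundedOn_of_lec hκ id TopGraph.LEic.lec
  · exact TopGraph.not_wellFoundedOn_of_lec hκ TopGraph.LEic.lec id
  · exact TopGraph.exists_antichain TopGraph.LEic.refl
      (fun A => TopGraph.orbitGraph (TopGraph.CycleSpace (TopGraph.twinSet A)))
      (fun A => TopGraph.classG_anti hκ
        (TopGraph.CycleSpace.orbitGraph_mem_classG (TopGraph.twinSet_infinite A)))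
      fun A A' h => TopGraph.eq_of_twinSet_subset (TopGraph.CycleSpace.subset_of_leic h)
  · exact TopGraph.exists_antichain TopGraph.LEc.refl
      (fun A => TopGraph.orbitGraph (TopGraph.Odometer (TopGraph.twinSet A)))
      (fun A => TopGraph.classG_anti (by omega)
        (TopGraph.Odometer.orbitGraph_mem_classG (TopGraph.twinSet_infinite A).nonempty))
      fun A A' h => (TopGraph.eq_of_twinSet_subset
        (TopGraph.Odometer.subset_of_lec (TopGraph.twinSet_infinite A).nonempty h)).symm
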